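/- Let $\kappa,n\ge 0$ be integers, and let $E^1,E^2$ be two independent ideal block ciphers with $\kappa$-bit keys and $n$-bit blocks (for each $j$ and each key $i$, $E^j_i$ is an independent uniformly random permutation of $\{0,1\}^n$). For $k\in\{0,1\}^\kappa$ and $k_1,k_2\in\{0,1\}^n$ put $$\mathsf{EFX}_{k,k_1,k_2}(x)=E^2_k\bigl(k_2\oplus E^1_k(k_1\oplus x)\bigr).$$ A (computationally unbounded, adaptive, randomized) adversary $\mathcal A$ has forward and backward access to $E^1,E^2$ under keys of its choice (offline queries) and to a permutation of $\{0,1\}^n$ (online queries), and outputs a bit. In the real world the online permutation is $\mathsf{EFX}_{k,k_1,k_2}$ with $(k,k_1,k_2)$ uniform in $\{0,1\}^{\kappa+2n}$; in the ideal world it is a uniformly random permutation of $\{0,1\}^n$; in both cases this is independent of $E^1,E^2$ and of the coins of $\mathcal A$. The advantage is $$\mathrm{Adv}^{\mathrm{sprp}}(\mathcal A)=\Pr[\mathcal A\to 1\text{ in the real world}]-\Pr[\mathcal A\to 1\text{ in the ideal world}].$$ Suppose that $\mathcal A$ always makes at most $D$ online and at most $T$ offline queries, where an online query is counted by its input point $x$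 (the input of a forward or the output of a backward query), an offline query by the triple (cipher, key, input point), and repetitions are not counted. Then: 1. If $D\ge 1$ and $2^n-\bigl(\tfrac TD\cdot\tfrac{2^{2n}}{2^\kappa}\bigr)^{1/3}-D+1>0$, then $$\mathrm{Adv}^{\mathrm{sprp}}(\mathcal A)\le \frac32\cdot\frac{TD}{2^{\kappa+n}}+\left(\frac{T^2D}{2^{2\kappa+2n}}\right)^{\frac13}+\left(\frac{2^{4n}\,T^2D}{2^{2(\kappa+1)}\,(2^n-D+1)^3\,\bigl(2^n-(\tfrac TD\cdot\tfrac{2^{2n}}{2^\kappa})^{1/3}-D+1\bigr)^3}\right)^{\frac13}.$$ 2. Without these two conditions, $$\mathrm{Adv}^{\mathrm{sprp}}(\mathcal A)\le \frac32\cdot\frac{T}{2^{\kappa+n/2}}.$$ -/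

import Mathlib

/-- An `n`-bit block cipher with `κ`-bit keys: a permutation of `{0,1}^n` for each key. -/
abbrev BlockCipher (κ n : ℕ) : Type := BitVec κ → Equiv.Perm (BitVec n)

/-- Key whitening `x ↦ k ⊕ x`. -/
def whiten {n : ℕ} (k : BitVec n) : Equiv.Perm (BitVec n) where
  toFun x := k ^^^ x
  invFun x := k ^^^ x
  left_inv x := by simp
  right_inv x := by simp

/-- The extended FX construction `x ↦ E²_k (k₂ ⊕ E¹_k (k₁ ⊕ x))`, where `E 0` is the first
block cipher `E¹` and `E 1` is the second block cipher `E²`. -/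
def EFX {κ n : ℕ} (E : Fin 2 → BlockCipher κ n) (k : BitVec κ) (k₁ k₂ : BitVec n) :
    Equiv.Perm (BitVec n) :=
  (whiten k₁).trans ((E 0 k).trans ((whiten k₂).trans (E 1 k)))

theorem EFX_apply {κ n : ℕ} (E : Fin 2 → BlockCipher κ n) (k : BitVec κ) (k₁ k₂ x : BitVec n) :
    EFX E k k₁ k₂ x = E 1 k (k₂ ^^^ E 0 k (k₁ ^^^ x)) := rfl

/-- A deterministic, computationally unbounded, adaptive strategy: a finite tree whose inner
nodes are oracle queries (the subtree taken next depends on the answer) and whose leaves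
are the output bits. `enc x` and `dec y` are the forward and backward online queries; `fwd j i a`
and `bwd j i b` are the forward and backward offline queries to the `j`-th ideal cipher
under the key `i`. -/
inductive Strategy (κ n : ℕ) : Type
  | output (b : Bool) : Strategy κ n
  | enc (x : BitVec n) (next : BitVec n → Strategy κ n) : Strategy κ n
  | dec (y : BitVec n) (next : BitVec n → Strategy κ n) : Strategy κ n
  | fwd (j : Fin 2) (i : BitVec κ) (a : BitVec n) (next : BitVec n → Strategy κ n) : Strategy κ n
  | bwd (j : Fin 2) (i : BitVec κ) (b : BitVec n) (next : BitVec n → Strategy κ n) : Strategy κ n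

namespace Strategy

variable {κ n : ℕ}

/-- The output bit of a strategy interacting with the ciphers `E` and the online permutation `P`. -/
def run (E : Fin 2 → BlockCipher κ n) (P : Equiv.Perm (BitVec n)) : Strategy κ n → Bool
  | output b => b
  | enc x next => run E P (next (P x))
  | dec y next => run E P (next (P.symm y))
  | fwd j i a next => run E P (next (E j i a))
  | bwd j i b next => run E P (next ((E j i).symm b))

/-- The set of all inputs of encryption queries and outputs of decryption queries in a run. -/
def onlinePoints (E : Fin 2 → BlockCipher κ n) (P : Equiv.Perm (BitVec n)) :
    Strategy κ n → Finset (BitVec n)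
  | output _ => ∅
  | enc x next => insert x (onlinePoints E P (next (P x)))
  | dec y next => insert (P.symm y) (onlinePoints E P (next (P.symm y)))
  | fwd j i a next => onlinePoints E P (next (E j i a))
  | bwd j i b next => onlinePoints E P (next ((E j i).symm b))

/-- The set of all triples `(j, i, a)` such that, in a run, `a` is the input of a forward query
or the output of a backward query to the `j`-th cipher under the key `i`. -/
def offlinePoints (E : Fin 2 → BlockCipher κ n) (P : Equiv.Perm (BitVec n)) :
    Strategy κ n → Finset (Fin 2 × BitVec κ × BitVec n)
  | output _ => ∅
  | enc x next => offlinePoints E P (next (P x))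
  | dec y next => offlinePoints E P (next (P.symm y))
  | fwd j i a next => insert (j, i, a) (offlinePoints E P (next (E j i a)))
  | bwd j i b next =>
      insert (j, i, (E j i).symm b) (offlinePoints E P (next ((E j i).symm b)))

/-- In every run, the strategy makes at most `D` (distinct) online queries and at most `T`
(distinct) offline queries. -/
def QueryBound (s : Strategy κ n) (D T : ℕ) : Prop :=
  ∀ (E : Fin 2 → BlockCipher κ n) (P : Equiv.Perm (BitVec n)),
    (s.onlinePoints E P).card ≤ D ∧ (s.offlinePoints E P).card ≤ T

end Strategy

noncomputable section

instance instFintypeBitVecEFX (m : ℕ) : Fintype (BitVec m) :=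
  Fintype.ofEquiv (Fin (2 ^ m)) ⟨BitVec.ofFin, BitVec.toFin, fun _ => rfl, fun _ => rfl⟩

/-- A (randomized) adversary: a probability distribution, given by its random coins, on
deterministic strategies. -/
abbrev Adversary (κ n : ℕ) : Type := PMF (Strategy κ n)

/-- The adversary makes at most `D` online and at most `T` offline queries, whatever its coins. -/
def Adversary.QueryBound {κ n : ℕ} (A : Adversary κ n) (D T : ℕ) : Prop :=
  ∀ s ∈ A.support, s.QueryBound D T

/-- The output bit of `A` in the real world: uniform independent ideal ciphers, uniform
independent keys, and `EFX` as the online permutation. -/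
def realWorld {κ n : ℕ} (A : Adversary κ n) : PMF Bool := do
  let s ← A
  let E ← PMF.uniformOfFintype (Fin 2 → BlockCipher κ n)
  let k ← PMF.uniformOfFintype (BitVec κ)
  let k₁ ← PMF.uniformOfFintype (BitVec n)
  let k₂ ← PMF.uniformOfFintype (BitVec n)
  return s.run E (EFX E k k₁ k₂)

/-- The output bit of `A` in the ideal world: uniform independent ideal ciphers and an independent
uniform permutation as the online permutation. -/
def idealWorld {κ n : ℕ} (A : Adversary κ n) : PMF Bool := do
  let s ← A
  let E ← PMF.uniformOfFintype (Fin 2 → BlockCipher κ n)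
  let p ← PMF.uniformOfFintype (Equiv.Perm (BitVec n))
  return s.run E p

/-- The sPRP advantage of `A` against `EFX`. -/
def advSPRP {κ n : ℕ} (A : Adversary κ n) : ℝ :=
  (realWorld A true).toReal - (idealWorld A true).toReal

end

/-- The H-coefficient technique for transcripts given as classes of an equivalence relation. -/
theorem sum_div_card_sub_le_of_hcoeff {Ω R : Type*} [Fintype Ω] [Fintype R]
    (g : R → Ω) (rel : Ω → Ω → Prop) (hrel : Equivalence rel) (f ε : Ω → ℝ)
    (hf0 : ∀ ω, 0 ≤ f ω) (hf1 : ∀ ω, f ω ≤ 1) (hf : ∀ ω ω', rel ω ω' → f ω' = f ω)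
    (hε : ∀ ω, 0 ≤ ε ω)
    (h : ∀ ω, (1 - ε ω) * Nat.card {ω' // rel ω ω'} / Fintype.card Ω
      ≤ Nat.card {r // rel ω (g r)} / Fintype.card R) :
    (∑ ω, f ω) / Fintype.card Ω - (∑ ω, ε ω) / Fintype.card Ω
      ≤ (∑ r, f (g r)) / Fintype.card R := by
  classical
  have hpos : ∀ ω, (0 : ℝ) < Nat.card {ω' // rel ω ω'} := fun ω => by
    have : Nonempty {ω' // rel ω ω'} := ⟨⟨ω, hrel.refl ω⟩⟩
    exact_mod_cast Nat.card_pos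
  have hcard : ∀ ω ω', rel ω ω' →
      Nat.card {x // rel ω' x} = Nat.card {x // rel ω x} := fun ω ω' hω => by
    congr! 2
    ext x
    exact ⟨fun hx => hrel.trans hω hx, fun hx => hrel.trans (hrel.symm hω) hx⟩
  have key : ∑ r, f (g r) = ∑ ω, f ω * Nat.card {r // rel ω (g r)} / Nat.card {x // rel ω x} := by
    have h1 : ∀ r, f (g r) = ∑ ω, if rel ω (g r) then f ω / Nat.card {x // rel ω x} else 0 := by
      intro r
      have : ∀ ω, (if rel ω (g r) then f ω / Nat.card {x // rel ω x} else 0)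
          = if rel (g r) ω then f (g r) / Nat.card {x // rel (g r) x} else 0 := by
        intro ω
        by_cases hr : rel ω (g r)
        · rw [if_pos hr, if_pos (hrel.symm hr), hf _ _ hr, hcard _ _ hr]
        · rw [if_neg hr, if_neg fun hr' => hr (hrel.symm hr')]
      rw [Finset.sum_congr rfl fun ω _ => this ω, ← Finset.sum_filter, Finset.sum_const, nsmul_eq_mul,
        ← Fintype.card_subtype, ← Nat.card_eq_fintype_card, mul_div_cancel₀ _ (hpos _).ne']
    rw [Finset.sum_congr rfl fun r _ => h1 r, Finset.sum_comm]
    refine Finset.sum_congr rfl fun ω _ => ?_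
    rw [← Finset.sum_filter, Finset.sum_const, nsmul_eq_mul, ← Fintype.card_subtype,
      ← Nat.card_eq_fintype_card]
    ring
  rw [key, ← sub_div, ← Finset.sum_sub_distrib, Finset.sum_div, Finset.sum_div]
  refine Finset.sum_le_sum fun ω _ => ?_
  calc (f ω - ε ω) / Fintype.card Ω ≤ f ω * (1 - ε ω) / Fintype.card Ω := by
        gcongr
        nlinarith [hε ω, hf1 ω]
    _ = f ω * ((1 - ε ω) * Nat.card {ω' // rel ω ω'} / Fintype.card Ω)
          / Nat.card {x // rel ω x} := by
        have := (hpos ω).ne'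
        field_simp
    _ ≤ f ω * (Nat.card {r // rel ω (g r)} / Fintype.card R) / Nat.card {x // rel ω x} := by
        exact div_le_div_of_nonneg_right (mul_le_mul_of_nonneg_left (h ω) (hf0 ω)) (hpos ω).le
    _ = _ := by ring

/-- The number of permutations that extend a given partial injection. -/
theorem card_perm_extending {α ι : Type*} [Finite α] {s t : ι → α}
    (hs : s.Injective) (ht : t.Injective) :
    Nat.card {σ : Equiv.Perm α // ∀ i, σ (s i) = t i} = (Nat.card α - Nat.card ι).factorial := by
  classical
  have : Fintype α := Fintype.ofFinite α
  have : Finite ι := Finite.of_injective s hs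
  let e : {x // x ∈ Set.range s} ≃ {x // x ∈ Set.range t} :=
    (Equiv.ofInjective s hs).symm.trans (Equiv.ofInjective t ht)
  let σ₀ : Equiv.Perm α := e.extendSubtype
  have hσ₀ : ∀ i, σ₀ (s i) = t i := fun i => by
    rw [Equiv.extendSubtype_apply_of_mem _ _ ⟨i, rfl⟩]
    simp only [e, Equiv.trans_apply]
    have : (Equiv.ofInjective s hs).symm ⟨s i, ⟨i, rfl⟩⟩ = i := by
      rw [Equiv.symm_apply_eq]; rfl
    rw [this]; rfl
  have e1 : {σ : Equiv.Perm α // ∀ i, σ (s i) = t i} ≃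
      {σ : Equiv.Perm α // ∀ x, ¬ (x ∉ Set.range s) → σ x = x} :=
    { toFun := fun σ => ⟨σ₀⁻¹ * σ.1, fun x hx => by
        obtain ⟨i, rfl⟩ := not_not.1 hx
        rw [Equiv.Perm.mul_apply, σ.2 i, ← hσ₀ i, Equiv.Perm.inv_eq_iff_eq]⟩
      invFun := fun σ => ⟨σ₀ * σ.1, fun i => by
        rw [Equiv.Perm.mul_apply, σ.2 _ (not_not.2 ⟨i, rfl⟩), hσ₀]⟩
      left_inv := fun σ => by simp
      right_inv := fun σ => by simp }
  rw [Nat.card_congr (e1.trans (Equiv.Perm.subtypeEquivSubtypePerm _).symm),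
    Nat.card_eq_fintype_card, Fintype.card_perm, Fintype.card_subtype_compl,
    ← Nat.card_eq_fintype_card, ← Nat.card_eq_fintype_card]
  congr 2
  exact Nat.card_congr (Equiv.ofInjective s hs).symm

/-- The number of permutations that agree with a given one on a set. -/
theorem card_perm_agree {α : Type*} [Finite α] (σ₀ : Equiv.Perm α) (S : Finset α) :
    Nat.card {σ : Equiv.Perm α // ∀ x ∈ S, σ x = σ₀ x} = (Nat.card α - S.card).factorial := by
  have := card_perm_extending (s := fun x : S => (x : α)) (t := fun x : S => σ₀ x)
    Subtype.val_injective (σ₀.injective.comp Subtype.val_injective)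
  simpa using this

/-- Composing with a fully specified permutation: the number of pairs `(σ₁, σ₂)` extending
partial permutations with prescribed composition. -/
theorem factorial_le_card_pairs_comp_eq {α : Type*} [Finite α] (p₁ p₂ p w₁ w₂ : Equiv.Perm α)
    (A B : Finset α) (h₁ : ∀ a ∈ A, ∀ b ∈ B, w₁ (p.symm (p₂ b)) ≠ a)
    (h₂ : ∀ a ∈ A, ∀ b ∈ B, w₂ (p₁ a) ≠ b) :
    (Nat.card α - (A.card + B.card)).factorial ≤
      Nat.card {q : Equiv.Perm α × Equiv.Perm α // (∀ x ∈ A, q.1 x = p₁ x) ∧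
        (∀ x ∈ B, q.2 x = p₂ x) ∧ ∀ x, q.2 (w₂ (q.1 (w₁ x))) = p x} := by
  have hc := card_perm_extending (α := α)
    (s := Sum.elim (fun x : A => (x : α)) (fun x : B => w₁ (p.symm (p₂ x))))
    (t := Sum.elim (fun x : A => p₁ x) (fun x : B => w₂.symm x))
    (Subtype.val_injective.sumElim
      (w₁.injective.comp (p.symm.injective.comp (p₂.injective.comp Subtype.val_injective)))
      fun a b => (h₁ a a.2 b b.2).symm)
    ((p₁.injective.comp Subtype.val_injective).sumElim
      (w₂.symm.injective.comp Subtype.val_injective)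
      fun a b hab => h₂ a a.2 b b.2 ((Equiv.eq_symm_apply _).1 hab))
  rw [Nat.card_sum, Nat.card_eq_finsetCard, Nat.card_eq_finsetCard] at hc
  rw [← hc]
  refine Nat.card_le_card_of_injective
    (fun σ => ⟨(σ.1, p * w₁⁻¹ * σ.1⁻¹ * w₂⁻¹), ?_, ?_, ?_⟩) ?_
  · exact fun x hx => σ.2 (Sum.inl ⟨x, hx⟩)
  · intro x hx
    have := σ.2 (Sum.inr ⟨x, hx⟩)
    simp only [Sum.elim_inr] at this
    simp only [Equiv.Perm.mul_apply, Equiv.Perm.inv_def, ← this, Equiv.symm_apply_apply,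
      Equiv.apply_symm_apply]
  · intro x
    simp [Equiv.Perm.mul_apply, Equiv.Perm.inv_def]
  · intro σ τ hστ
    exact Subtype.ext (congrArg (fun q => q.1.1) hστ)

/-- The number of pairs `(σ₁, σ₂)` extending partial permutations whose composition is prescribed
on a set `Q`, when no chain of three known values closes up. -/
theorem descFactorial_mul_le_card_pairs_comp_eq_on {α : Type*} [Finite α] [DecidableEq α]
    (p₁ p₂ p w₁ w₂ : Equiv.Perm α) (A B Q : Finset α) (h₁ : ∀ x ∈ Q, w₁ x ∉ A)
    (h₂ : ∀ x ∈ Q, p₂.symm (p x) ∈ B → ∀ a ∈ A, w₂ (p₁ a) ≠ p₂.symm (p x)) :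
    (Nat.card α - (A.card + B.card)).descFactorial (Q.filter fun x => p₂.symm (p x) ∉ B).card *
      ((Nat.card α - (A.card + Q.card)).factorial *
        (Nat.card α - (B.card + (Q.filter fun x => p₂.symm (p x) ∉ B).card)).factorial) ≤
      Nat.card {q : Equiv.Perm α × Equiv.Perm α // (∀ x ∈ A, q.1 x = p₁ x) ∧
        (∀ x ∈ B, q.2 x = p₂ x) ∧ ∀ x ∈ Q, q.2 (w₂ (q.1 (w₁ x))) = p x} := by
  have : Fintype α := Fintype.ofFinite α
  set U := Q.filter fun x => p₂.symm (p x) ∉ B with hU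
  let V := {y // y ∉ A.image p₁ ∪ B.image w₂.symm}
  let s₁ : A ⊕ Q → α := Sum.elim (fun a => a) (fun x => w₁ x)
  let t₁ : (U ↪ V) → A ⊕ Q → α := fun v => Sum.elim (fun a => p₁ a)
    (fun x => if h : p₂.symm (p x) ∈ B then w₂.symm (p₂.symm (p x))
      else v ⟨x, Finset.mem_filter.2 ⟨x.2, h⟩⟩)
  let s₂ : (U ↪ V) → B ⊕ U → α := fun v => Sum.elim (fun b => b) (fun x => w₂ (v x))
  let t₂ : B ⊕ U → α := Sum.elim (fun b => p₂ b) (fun x => p x)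
  have hV : ∀ y : V, (∀ a ∈ A, p₁ a ≠ y) ∧ ∀ b ∈ B, w₂ y ≠ b := by
    intro y
    have := y.2
    simp only [Finset.mem_union, Finset.mem_image, not_or, not_exists, not_and] at this
    refine ⟨this.1, fun b hb h => this.2 b hb ?_⟩
    rw [← h, Equiv.symm_apply_apply]
  have hs₁ : s₁.Injective := Subtype.val_injective.sumElim
    (w₁.injective.comp Subtype.val_injective) fun a x h => h₁ x x.2 (h ▸ a.2)
  have ht₁ : ∀ v, (t₁ v).Injective := by
    intro v
    refine (p₁.injective.comp Subtype.val_injective).sumElim ?_ ?_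
    · intro x y hxy
      by_cases hx : p₂.symm (p x) ∈ B <;> by_cases hy : p₂.symm (p y) ∈ B <;>
        simp only [hx, hy, dite_true, dite_false] at hxy
      · exact Subtype.ext (p.injective (p₂.symm.injective (w₂.symm.injective hxy)))
      · exact absurd ((Equiv.symm_apply_eq _).1 hxy).symm ((hV _).2 _ hx)
      · exact absurd ((Equiv.symm_apply_eq _).1 hxy.symm).symm ((hV _).2 _ hy)
      · have := v.injective (Subtype.ext hxy)
        exact Subtype.ext (congrArg (fun z : U => (z : α)) this)
    · intro a x hax
      by_cases hx : p₂.symm (p x) ∈ B <;> simp only [hx, dite_true, dite_false] at hax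
      · exact h₂ x x.2 hx a a.2 ((Equiv.eq_symm_apply _).1 hax)
      · exact (hV _).1 a a.2 hax
  have hs₂ : ∀ v, (s₂ v).Injective := fun v => Subtype.val_injective.sumElim
    (w₂.injective.comp (Subtype.val_injective.comp v.injective))
    fun b x h => (hV (v x)).2 b b.2 h.symm
  have ht₂ : t₂.Injective := (p₂.injective.comp Subtype.val_injective).sumElim
    (p.injective.comp Subtype.val_injective) fun b x h =>
      (Finset.mem_filter.1 x.2).2 (by
        have h' : p₂ b = p x := h
        rw [← h', Equiv.symm_apply_apply]; exact b.2)
  have hc : Nat.card (Σ v : U ↪ V, {σ : Equiv.Perm α // ∀ i, σ (s₁ i) = t₁ v i} ×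
      {σ : Equiv.Perm α // ∀ i, σ (s₂ v i) = t₂ i}) = Nat.card (U ↪ V) *
      ((Nat.card α - (A.card + Q.card)).factorial *
        (Nat.card α - (B.card + U.card)).factorial) := by
    rw [Nat.card_sigma]
    simp_rw [Nat.card_prod, card_perm_extending hs₁ (ht₁ _), card_perm_extending (hs₂ _) ht₂,
      Nat.card_sum, Nat.card_eq_finsetCard]
    rw [Finset.sum_const, Finset.card_univ, smul_eq_mul, Nat.card_eq_fintype_card (α := U ↪ V)]
  have hcV : (Nat.card α - (A.card + B.card)).descFactorial U.card ≤ Nat.card (U ↪ V) := by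
    rw [Nat.card_eq_fintype_card (α := U ↪ V), Fintype.card_embedding_eq, Fintype.card_coe]
    refine Nat.descFactorial_le _ ?_
    rw [Fintype.card_subtype_compl, Nat.card_eq_fintype_card, Fintype.card_coe]
    refine Nat.sub_le_sub_left ((Finset.card_union_le _ _).trans ?_) _
    exact add_le_add Finset.card_image_le Finset.card_image_le
  refine (Nat.mul_le_mul_right _ hcV).trans (hc ▸ ?_)
  refine Nat.card_le_card_of_injective (fun z => ⟨(z.2.1.1, z.2.2.1), ?_, ?_, ?_⟩) ?_
  · exact fun x hx => z.2.1.2 (Sum.inl ⟨x, hx⟩)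
  · exact fun x hx => z.2.2.2 (Sum.inl ⟨x, hx⟩)
  · intro x hx
    have h := z.2.1.2 (Sum.inr ⟨x, hx⟩)
    by_cases hB : p₂.symm (p x) ∈ B <;>
      simp only [s₁, t₁, Sum.elim_inr, hB, dite_true, dite_false] at h
    · have h' := z.2.2.2 (Sum.inl ⟨_, hB⟩)
      simp only [s₂, t₂, Sum.elim_inl, Equiv.apply_symm_apply] at h'
      simpa only [h, Equiv.apply_symm_apply] using h'
    · have h' := z.2.2.2 (Sum.inr ⟨x, Finset.mem_filter.2 ⟨hx, hB⟩⟩)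
      simp only [s₂, t₂, Sum.elim_inr] at h'
      simpa only [h] using h'
  · rintro ⟨v, σ, τ⟩ ⟨v', σ', τ'⟩ h
    have hσ : σ.1 = σ'.1 := congrArg (fun q => q.1.1) h
    have hτ : τ.1 = τ'.1 := congrArg (fun q => q.1.2) h
    have hv : v = v' := by
      ext x
      have hx := Finset.mem_filter.1 x.2
      have h1 := σ.2 (Sum.inr ⟨x, hx.1⟩)
      have h2 := σ'.2 (Sum.inr ⟨x, hx.1⟩)
      simp only [t₁, Sum.elim_inr, hx.2, dite_false] at h1 h2
      rw [← h1, ← h2, hσ]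
    subst hv
    rw [Subtype.ext hσ, Subtype.ext hτ]

theorem pow_mul_descFactorial_mul_descFactorial_le {N a b j : ℕ} {c : ℝ} (hc : c ≤ 1)
    (hN : a + b + j ≤ N)
    (h : ∀ i < j, (1 - c) * ((N - i - a : ℝ) * (N - i - b)) ≤ (N - i - a - b) * (N - i)) :
    (1 - c) ^ j * (((N - a).descFactorial j : ℝ) * (N - b).descFactorial j) ≤
      (N - (a + b)).descFactorial j * N.descFactorial j := by
  induction j with
  | zero => simp
  | succ j ih =>
    have h1 := ih (by omega) fun i hi => h i (by omega)
    have h2 := h j (by omega)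
    have e1 : ((N - a - j : ℕ) : ℝ) = N - j - a := by
      rw [Nat.cast_sub (by omega), Nat.cast_sub (by omega)]; ring
    have e2 : ((N - b - j : ℕ) : ℝ) = N - j - b := by
      rw [Nat.cast_sub (by omega), Nat.cast_sub (by omega)]; ring
    have e3 : ((N - (a + b) - j : ℕ) : ℝ) = N - j - a - b := by
      rw [Nat.cast_sub (by omega), Nat.cast_sub (by omega)]; push_cast; ring
    have e4 : ((N - j : ℕ) : ℝ) = N - j := by
      rw [Nat.cast_sub (by omega)]
    have e5 : (0 : ℝ) ≤ (N - j - a - b) * (N - j) := by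
      rw [← e3, ← e4]; positivity
    simp only [Nat.descFactorial_succ, Nat.cast_mul, e1, e2, e3, e4]
    calc _ = ((1 - c) * ((N - j - a : ℝ) * (N - j - b))) * ((1 - c) ^ j *
          (((N - a).descFactorial j : ℝ) * (N - b).descFactorial j)) := by ring
      _ ≤ ((N - j - a - b) * (N - j)) * ((N - (a + b)).descFactorial j * N.descFactorial j) :=
          mul_le_mul h2 h1 (mul_nonneg (pow_nonneg (by linarith) _) (by positivity)) e5
      _ = _ := by ring

theorem pow_mul_descFactorial_sub_le {N N' a h : ℕ} (hN : 0 < N) (hN' : N' ≤ N) :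
    (1 + (a : ℝ) / N) ^ h * (N' - a).descFactorial h ≤ N'.descFactorial h := by
  have hN0 : (0 : ℝ) < N := by exact_mod_cast hN
  induction h with
  | zero => simp
  | succ h ih =>
    have key : (1 + (a : ℝ) / N) * (N' - a - h : ℕ) ≤ (N' - h : ℕ) := by
      rcases Nat.eq_zero_or_pos (N' - a - h) with h0 | h0
      · rw [h0]; simp
      · have e1 : ((N' - a - h : ℕ) : ℝ) = N' - h - a := by
          rw [Nat.cast_sub (by omega), Nat.cast_sub (by omega)]; ring
        have e2 : ((N' - h : ℕ) : ℝ) = N' - h := Nat.cast_sub (by omega)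
        have e3 : (N' : ℝ) ≤ N := by exact_mod_cast hN'
        have e4 : (a : ℝ) / N * N = a := by field_simp
        have e5 : 0 ≤ (a : ℝ) / N := by positivity
        rw [e1, e2]
        nlinarith [mul_nonneg e5 (by positivity : (0 : ℝ) ≤ h),
          mul_nonneg e5 (by positivity : (0 : ℝ) ≤ a), mul_nonneg e5 (sub_nonneg.2 e3)]
    simp only [Nat.descFactorial_succ, Nat.cast_mul]
    calc _ = ((1 + (a : ℝ) / N) * (N' - a - h : ℕ)) *
          ((1 + (a : ℝ) / N) ^ h * (N' - a).descFactorial h) := by ring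
      _ ≤ _ := mul_le_mul key ih (by positivity) (by positivity)

/-- The ratio between the real and the ideal probability of a transcript without bad chains. -/
theorem pow_mul_factorials_le {N a b u h : ℕ} {c : ℝ} (hN0 : 0 < N) (hc : c ≤ 1)
    (hN : a + b + (u + h) ≤ N)
    (hi : ∀ i < u, (1 - c) * ((N - i - a : ℝ) * (N - i - b)) ≤ (N - i - a - b) * (N - i)) :
    (1 - c) ^ u * (1 + (a : ℝ) / N) ^ h *
        ((N - a).factorial * (N - b).factorial * (N - (u + h)).factorial : ℕ) ≤
      (N.factorial * ((N - (a + b)).descFactorial u *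
        ((N - (a + (u + h))).factorial * (N - (b + u)).factorial)) : ℕ) := by
  have h1 := pow_mul_descFactorial_mul_descFactorial_le hc (by omega) hi
  have h2 := pow_mul_descFactorial_sub_le (a := a) (h := h) hN0 (Nat.sub_le N u)
  have e1 : N.factorial = (N - (u + h)).factorial * ((N - u).descFactorial h * N.descFactorial u) := by
    rw [← Nat.factorial_mul_descFactorial (show u + h ≤ N by omega),
      ← Nat.descFactorial_mul_descFactorial (show u ≤ u + h by omega), Nat.add_sub_cancel_left]
  have e2 : (N - a).factorial = (N - (a + (u + h))).factorial *
      ((N - u - a).descFactorial h * (N - a).descFactorial u) := by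
    rw [← Nat.factorial_mul_descFactorial (show u + h ≤ N - a by omega),
      ← Nat.descFactorial_mul_descFactorial (show u ≤ u + h by omega), Nat.add_sub_cancel_left,
      Nat.sub_sub, Nat.sub_right_comm]
  have e3 : (N - b).factorial = (N - (b + u)).factorial * (N - b).descFactorial u := by
    rw [← Nat.factorial_mul_descFactorial (show u ≤ N - b by omega), Nat.sub_sub]
  rw [e1, e2, e3]
  push_cast
  calc _ = ((1 - c) ^ u * (((N - a).descFactorial u : ℝ) * (N - b).descFactorial u)) *
        ((1 + (a : ℝ) / N) ^ h * (N - u - a).descFactorial h) *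
        ((N - (a + (u + h))).factorial * (N - (b + u)).factorial * (N - (u + h)).factorial) := by
          ring
    _ ≤ ((N - (a + b)).descFactorial u * N.descFactorial u) * (N - u).descFactorial h *
        ((N - (a + (u + h))).factorial * (N - (b + u)).factorial * (N - (u + h)).factorial) := by
          gcongr
    _ = _ := by ring

theorem one_sub_le_pow_mul {c δ r u v n₁ n₂ : ℝ} {j h : ℕ} (hc0 : 0 ≤ c) (hc : c ≤ 1)
    (hδ : j * c ≤ δ) (hr : 0 ≤ r) (hu : u = h * r) (huv : u ≤ v)
    (h₁ : 1 - v ≤ n₁) (h₂ : 1 - u ≤ n₂) (h0 : 0 ≤ n₁) (h0' : 0 ≤ n₂) :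
    1 - (δ + 3 / 2 * v) ≤ (1 - c) ^ j * (1 + r) ^ h * (n₁ * n₂) := by
  have hu0 : 0 ≤ u := by rw [hu]; positivity
  have hδ0 : 0 ≤ δ := le_trans (by positivity) hδ
  rcases le_or_gt (1 - (δ + 3 / 2 * v)) 0 with hneg | hpos
  · refine hneg.trans ?_
    have : 0 ≤ 1 - c := by linarith
    positivity
  · have hp1 : 1 - δ ≤ (1 - c) ^ j := by
      have := one_add_mul_le_pow (a := -c) (by linarith) j
      rw [← sub_eq_add_neg] at this
      linarith
    have hp2 : 1 + u ≤ (1 + r) ^ h := by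
      rw [hu]; exact one_add_mul_le_pow (by linarith) h
    have hv : v < 2 / 3 := by linarith
    calc 1 - (δ + 3 / 2 * v) ≤ (1 - δ) * (1 - 3 / 2 * v) := by nlinarith
      _ ≤ (1 - δ) * ((1 + u) * ((1 - v) * (1 - u))) := by
        refine mul_le_mul_of_nonneg_left ?_ (by linarith)
        nlinarith [mul_nonneg (sub_nonneg.2 huv) (by linarith : 0 ≤ 1 - v),
          mul_nonneg (mul_nonneg (sub_nonneg.2 huv) (by linarith : 0 ≤ u + v)) (by linarith : 0 ≤ 1 - v),
          mul_nonneg (hu0.trans huv) (by nlinarith [sq_nonneg (v - 1/2)] : 0 ≤ 1 / 2 - v * (1 - v))]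
      _ ≤ (1 - c) ^ j * ((1 + r) ^ h * (n₁ * n₂)) := by
        have a1 : (1 - v) * (1 - u) ≤ n₁ * n₂ := mul_le_mul h₁ h₂ (by linarith) h0
        have a2 : (1 + u) * ((1 - v) * (1 - u)) ≤ (1 + r) ^ h * (n₁ * n₂) :=
          mul_le_mul hp2 a1 (mul_nonneg (by linarith) (by linarith)) (by positivity)
        exact mul_le_mul hp1 a2 (mul_nonneg (by linarith)
          (mul_nonneg (by linarith) (by linarith))) (pow_nonneg (by linarith) _)
      _ = _ := by ring

theorem factorial_sub_mul_factorial_sub_le {N a b : ℕ} (h : a + b ≤ N) :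
    (N - a).factorial * (N - b).factorial ≤ N.factorial * (N - (a + b)).factorial := by
  have e1 := Nat.factorial_mul_descFactorial (show a ≤ N by omega)
  have e2 := Nat.factorial_mul_descFactorial (show a ≤ N - b by omega)
  rw [← e1, ← e2, show N - b - a = N - (a + b) by omega]
  calc _ = (N - a).factorial * (N - (a + b)).factorial * (N - b).descFactorial a := by ring
    _ ≤ (N - a).factorial * (N - (a + b)).factorial * N.descFactorial a :=
      Nat.mul_le_mul_left _ (Nat.descFactorial_le _ (Nat.sub_le _ _))
    _ = _ := by ring

namespace Strategy

variable {κ n : ℕ}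

/-- A run only depends on the values of the oracles at the queried points. -/
theorem eq_of_agree (s : Strategy κ n) {E E' : Fin 2 → BlockCipher κ n}
    {P P' : Equiv.Perm (BitVec n)}
    (hE : ∀ j i a, (j, i, a) ∈ s.offlinePoints E P → E' j i a = E j i a)
    (hP : ∀ x ∈ s.onlinePoints E P, P' x = P x) :
    s.run E' P' = s.run E P ∧ s.offlinePoints E' P' = s.offlinePoints E P ∧
      s.onlinePoints E' P' = s.onlinePoints E P := by
  induction s with
  | output b => simp [run, offlinePoints, onlinePoints]
  | enc x next ih =>
    simp only [run, offlinePoints, onlinePoints, Finset.mem_insert, forall_eq_or_imp] at *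
    obtain ⟨h1, h2, h3⟩ := ih _ hE hP.2
    rw [hP.1]
    exact ⟨h1, h2, by rw [h3]⟩
  | dec y next ih =>
    simp only [run, offlinePoints, onlinePoints, Finset.mem_insert, forall_eq_or_imp] at *
    obtain ⟨h1, h2, h3⟩ := ih _ hE hP.2
    have : P'.symm y = P.symm y := by
      rw [Equiv.symm_apply_eq, hP.1, Equiv.apply_symm_apply]
    rw [this]
    exact ⟨h1, h2, by rw [h3]⟩
  | fwd j i a next ih =>
    simp only [run, offlinePoints, onlinePoints, Finset.mem_insert] at *
    obtain ⟨h1, h2, h3⟩ := ih _ (fun j' i' a' h => hE j' i' a' (Or.inr h)) hP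
    rw [hE j i a (Or.inl rfl)]
    exact ⟨h1, by rw [h2], h3⟩
  | bwd j i b next ih =>
    simp only [run, offlinePoints, onlinePoints, Finset.mem_insert] at *
    obtain ⟨h1, h2, h3⟩ := ih _ (fun j' i' a' h => hE j' i' a' (Or.inr h)) hP
    have : (E' j i).symm b = (E j i).symm b := by
      rw [Equiv.symm_apply_eq, hE j i _ (Or.inl rfl), Equiv.apply_symm_apply]
    rw [this]
    exact ⟨h1, by rw [h2], h3⟩

/-- The points at which a run queries the `j`-th cipher under the key `k`. -/
noncomputable def keyPoints (s : Strategy κ n) (ω : (Fin 2 → BlockCipher κ n) × Equiv.Perm (BitVec n))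
    (k : BitVec κ) (j : Fin 2) : Finset (BitVec n) :=
  Finset.univ.filter fun a => (j, k, a) ∈ s.offlinePoints ω.1 ω.2

theorem sum_card_keyPoints (s : Strategy κ n)
    (ω : (Fin 2 → BlockCipher κ n) × Equiv.Perm (BitVec n)) :
    ∑ k, ((s.keyPoints ω k 0).card + (s.keyPoints ω k 1).card) =
      (s.offlinePoints ω.1 ω.2).card := by
  have h : (s.offlinePoints ω.1 ω.2).card =
      ∑ z : Fin 2 × BitVec κ × BitVec n, if z ∈ s.offlinePoints ω.1 ω.2 then 1 else 0 := by
    rw [Finset.sum_boole]; simp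
  rw [h, Fintype.sum_prod_type, Fin.sum_univ_two]
  simp only [Fintype.sum_prod_type, keyPoints, Finset.card_filter, Finset.sum_add_distrib]

/-- Two ideal-world outcomes agree off the key `k`, on the queried points under `k`, and on the
online points `Q`. -/
def SameView (s : Strategy κ n)
    (Q : (Fin 2 → BlockCipher κ n) × Equiv.Perm (BitVec n) → Finset (BitVec n)) (k : BitVec κ)
    (ω ω' : (Fin 2 → BlockCipher κ n) × Equiv.Perm (BitVec n)) : Prop :=
  (∀ j i, i ≠ k → ω'.1 j i = ω.1 j i) ∧
    (∀ j, ∀ a ∈ s.keyPoints ω k j, ω'.1 j k a = ω.1 j k a) ∧ ∀ x ∈ Q ω, ω'.2 x = ω.2 x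

/-- `Q` contains the online points of a run, and is determined by the queried points. -/
structure IsOnlineCover (s : Strategy κ n)
    (Q : (Fin 2 → BlockCipher κ n) × Equiv.Perm (BitVec n) → Finset (BitVec n)) : Prop where
  subset : ∀ ω, s.onlinePoints ω.1 ω.2 ⊆ Q ω
  congr : ∀ ω ω', s.onlinePoints ω'.1 ω'.2 = s.onlinePoints ω.1 ω.2 → Q ω' = Q ω

variable {s : Strategy κ n}
  {Q : (Fin 2 → BlockCipher κ n) × Equiv.Perm (BitVec n) → Finset (BitVec n)} {k : BitVec κ}
  {ω ω' : (Fin 2 → BlockCipher κ n) × Equiv.Perm (BitVec n)}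

theorem SameView.eq (hQ : s.IsOnlineCover Q) (h : s.SameView Q k ω ω') :
    s.run ω'.1 ω'.2 = s.run ω.1 ω.2 ∧ s.keyPoints ω' k = s.keyPoints ω k ∧ Q ω' = Q ω := by
  obtain ⟨h1, h2, h3⟩ := h
  obtain ⟨e1, e2, e3⟩ := s.eq_of_agree (E := ω.1) (E' := ω'.1) (P := ω.2) (P' := ω'.2) (by
    intro j i a ha
    by_cases hi : i = k
    · subst hi
      exact h2 j a (by simpa [keyPoints] using ha)
    · rw [h1 j i hi]) fun x hx => h3 x (hQ.subset ω hx)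
  refine ⟨e1, ?_, hQ.congr _ _ e3⟩
  funext j
  simp only [keyPoints, e2]

theorem equivalence_sameView (hQ : s.IsOnlineCover Q) (k : BitVec κ) :
    Equivalence (s.SameView Q k) where
  refl ω := ⟨fun _ _ _ => rfl, fun _ _ _ => rfl, fun _ _ => rfl⟩
  symm {ω ω'} h := by
    obtain ⟨-, e2, e3⟩ := h.eq hQ
    exact ⟨fun j i hi => (h.1 j i hi).symm, fun j a ha => (h.2.1 j a (e2 ▸ ha)).symm,
      fun x hx => (h.2.2 x (e3 ▸ hx)).symm⟩
  trans {ω ω' ω''} h h' := by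
    obtain ⟨-, e2, e3⟩ := h.eq hQ
    exact ⟨fun j i hi => (h'.1 j i hi).trans (h.1 j i hi),
      fun j a ha => (h'.2.1 j a (e2 ▸ ha)).trans (h.2.1 j a ha),
      fun x hx => (h'.2.2 x (e3 ▸ hx)).trans (h.2.2 x hx)⟩

theorem card_sameView_le (s : Strategy κ n)
    (Q : (Fin 2 → BlockCipher κ n) × Equiv.Perm (BitVec n) → Finset (BitVec n)) (k : BitVec κ)
    (ω : (Fin 2 → BlockCipher κ n) × Equiv.Perm (BitVec n)) :
    Nat.card {ω' // s.SameView Q k ω ω'} ≤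
      (Nat.card (BitVec n) - (s.keyPoints ω k 0).card).factorial *
      (Nat.card (BitVec n) - (s.keyPoints ω k 1).card).factorial *
      (Nat.card (BitVec n) - (Q ω).card).factorial := by
  rw [← card_perm_agree (ω.1 0 k), ← card_perm_agree (ω.1 1 k), ← card_perm_agree ω.2,
    ← Nat.card_prod, ← Nat.card_prod]
  refine Nat.card_le_card_of_injective
    (fun ω' => ((⟨ω'.1.1 0 k, ω'.2.2.1 0⟩, ⟨ω'.1.1 1 k, ω'.2.2.1 1⟩), ⟨ω'.1.2, ω'.2.2.2⟩)) ?_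
  intro x y hxy
  simp only [Prod.mk.injEq, Subtype.mk.injEq] at hxy
  refine Subtype.ext (Prod.ext ?_ hxy.2)
  funext j i
  by_cases hi : i = k
  · subst hi
    fin_cases j
    · exact hxy.1.1
    · exact hxy.1.2
  · rw [x.2.1 j i hi, y.2.1 j i hi]

/-- The pairs of permutations that may replace the ciphers under the real key without changing
the view. -/
abbrev RealPairs (s : Strategy κ n)
    (Q : (Fin 2 → BlockCipher κ n) × Equiv.Perm (BitVec n) → Finset (BitVec n)) (k : BitVec κ)
    (ω : (Fin 2 → BlockCipher κ n) × Equiv.Perm (BitVec n)) (k₁ k₂ : BitVec n) : Type :=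
  {q : Equiv.Perm (BitVec n) × Equiv.Perm (BitVec n) //
    (∀ x ∈ s.keyPoints ω k 0, q.1 x = ω.1 0 k x) ∧
    (∀ x ∈ s.keyPoints ω k 1, q.2 x = ω.1 1 k x) ∧
    ∀ x ∈ Q ω, q.2 (whiten k₂ (q.1 (whiten k₁ x))) = ω.2 x}

theorem sum_card_realPairs_le (s : Strategy κ n)
    (Q : (Fin 2 → BlockCipher κ n) × Equiv.Perm (BitVec n) → Finset (BitVec n)) (k : BitVec κ)
    (ω : (Fin 2 → BlockCipher κ n) × Equiv.Perm (BitVec n)) :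
    ∑ k₁, ∑ k₂, Nat.card (s.RealPairs Q k ω k₁ k₂) ≤
      Nat.card {r : (Fin 2 → BlockCipher κ n) × BitVec n × BitVec n //
        s.SameView Q k ω (r.1, EFX r.1 k r.2.1 r.2.2)} := by
  rw [← Fintype.sum_prod_type' (f := fun k₁ k₂ => Nat.card (s.RealPairs Q k ω k₁ k₂)),
    ← Nat.card_sigma]
  let E' : Equiv.Perm (BitVec n) × Equiv.Perm (BitVec n) → Fin 2 → BlockCipher κ n :=
    fun q j => Function.update (ω.1 j) k (if j = 0 then q.1 else q.2)
  have h0 : ∀ q, E' q 0 k = q.1 := fun q => by simp [E']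
  have h1 : ∀ q, E' q 1 k = q.2 := fun q => by simp [E']
  refine Nat.card_le_card_of_injective
    (fun z => ⟨(E' z.2.1, z.1.1, z.1.2), ?_, ?_, ?_⟩) ?_
  · intro j i hi
    simp [E', hi]
  · intro j
    fin_cases j
    · simpa only [Fin.zero_eta, h0] using z.2.2.1
    · simpa only [Fin.mk_one, h1] using z.2.2.2.1
  · intro x hx
    have h := z.2.2.2.2 x hx
    rw [← h0, ← h1] at h
    exact h
  · rintro ⟨⟨k₁, k₂⟩, q⟩ ⟨⟨k₁', k₂'⟩, q'⟩ h
    have hE : E' q.1 = E' q'.1 := congrArg (fun r => r.1.1) h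
    obtain rfl : k₁ = k₁' := congrArg (fun r => r.1.2.1) h
    obtain rfl : k₂ = k₂' := congrArg (fun r => r.1.2.2) h
    have : q = q' := Subtype.ext (Prod.ext (by rw [← h0, ← h0, hE]) (by rw [← h1, ← h1, hE]))
    rw [this]

/-- The advantage of a strategy for a fixed key `k`. -/
theorem real_sub_ideal_le_of_ratio (hQ : s.IsOnlineCover Q) (k : BitVec κ)
    (ε : (Fin 2 → BlockCipher κ n) × Equiv.Perm (BitVec n) → ℝ) (hε : ∀ ω, 0 ≤ ε ω)
    (h : ∀ ω, (1 - ε ω) * (Nat.card (BitVec n) : ℝ) ^ 2 *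
        ((Nat.card (BitVec n) - (s.keyPoints ω k 0).card).factorial *
          (Nat.card (BitVec n) - (s.keyPoints ω k 1).card).factorial *
          (Nat.card (BitVec n) - (Q ω).card).factorial : ℕ) ≤
        ((Nat.card (BitVec n)).factorial *
          ∑ k₁, ∑ k₂, Nat.card (s.RealPairs Q k ω k₁ k₂) : ℕ)) :
    (∑ r : (Fin 2 → BlockCipher κ n) × BitVec n × BitVec n,
        if s.run r.1 (EFX r.1 k r.2.1 r.2.2) = true then (1 : ℝ) else 0) /
        Fintype.card ((Fin 2 → BlockCipher κ n) × BitVec n × BitVec n) ≤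
      (∑ ω : (Fin 2 → BlockCipher κ n) × Equiv.Perm (BitVec n),
        if s.run ω.1 ω.2 = true then (1 : ℝ) else 0) /
        Fintype.card ((Fin 2 → BlockCipher κ n) × Equiv.Perm (BitVec n)) +
      (∑ ω, ε ω) / Fintype.card ((Fin 2 → BlockCipher κ n) × Equiv.Perm (BitVec n)) := by
  have key := sum_div_card_sub_le_of_hcoeff
    (fun r : (Fin 2 → BlockCipher κ n) × BitVec n × BitVec n =>
      ((r.1, EFX r.1 k r.2.1 r.2.2) : (Fin 2 → BlockCipher κ n) × Equiv.Perm (BitVec n)))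
    (s.SameView Q k) (equivalence_sameView hQ k)
    (fun ω => 1 - if s.run ω.1 ω.2 = true then (1 : ℝ) else 0) ε
    (fun ω => by split_ifs <;> norm_num) (fun ω => by split_ifs <;> norm_num)
    (fun ω ω' hω => by rw [(hω.eq hQ).1]) hε ?_
  · rw [Finset.sum_sub_distrib, Finset.sum_sub_distrib, sub_div, sub_div] at key
    simp only [Finset.sum_const, Finset.card_univ, nsmul_eq_mul, mul_one] at key
    rw [div_self, div_self] at key
    · linarith
    all_goals exact_mod_cast Fintype.card_ne_zero
  · intro ω
    rcases le_or_gt (1 - ε ω) 0 with hneg | hpos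
    · refine le_trans (div_nonpos_of_nonpos_of_nonneg
        (mul_nonpos_of_nonpos_of_nonneg hneg ?_) ?_) ?_ <;> positivity
    · have hE : (0 : ℝ) < Fintype.card (Fin 2 → BlockCipher κ n) := by
        exact_mod_cast Fintype.card_pos
      have hN : (0 : ℝ) < Nat.card (BitVec n) := by exact_mod_cast Nat.card_pos
      have hN' : (0 : ℝ) < (Nat.card (BitVec n)).factorial := by
        exact_mod_cast Nat.factorial_pos _
      rw [Fintype.card_prod, Fintype.card_prod, Fintype.card_prod, Fintype.card_perm,
        ← Nat.card_eq_fintype_card (α := BitVec n), div_le_div_iff₀ (by push_cast; positivity)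
        (by push_cast; positivity)]
      have h1 := (Nat.cast_le (α := ℝ)).2 (card_sameView_le s Q k ω)
      have h2 := (Nat.cast_le (α := ℝ)).2 (sum_card_realPairs_le s Q k ω)
      have h3 := (h ω).trans_eq (Nat.cast_mul _ _)
      rw [Nat.cast_mul, Nat.cast_mul, Nat.cast_mul]
      calc _ = ((1 - ε ω) * (Nat.card (BitVec n) : ℝ) ^ 2 * Nat.card {ω' // s.SameView Q k ω ω'})
            * Fintype.card (Fin 2 → BlockCipher κ n) := by ring
        _ ≤ ((Nat.card (BitVec n)).factorial *
          (Nat.card {r : (Fin 2 → BlockCipher κ n) × BitVec n × BitVec n //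
            s.SameView Q k ω (r.1, EFX r.1 k r.2.1 r.2.2)} : ℝ)) *
            Fintype.card (Fin 2 → BlockCipher κ n) := by
          refine mul_le_mul_of_nonneg_right ?_ hE.le
          refine (mul_le_mul_of_nonneg_left h1 (by positivity)).trans (h3.trans ?_)
          exact mul_le_mul_of_nonneg_left h2 hN'.le
        _ = _ := by ring

end Strategy

theorem card_sub_mul_le_card_xor_ne {n : ℕ} (X Y : Finset (BitVec n)) :
    (Nat.card (BitVec n) : ℝ) - X.card * Y.card ≤
      (Finset.univ.filter fun k : BitVec n => ∀ x ∈ X, ∀ y ∈ Y, k ^^^ x ≠ y).card := by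
  have h := Finset.card_filter_add_card_filter_not (s := Finset.univ)
    (fun k : BitVec n => ∀ x ∈ X, ∀ y ∈ Y, k ^^^ x ≠ y)
  rw [Finset.card_univ, ← Nat.card_eq_fintype_card] at h
  have h2 : (Finset.univ.filter fun k : BitVec n => ¬ ∀ x ∈ X, ∀ y ∈ Y, k ^^^ x ≠ y).card ≤
      X.card * Y.card := by
    rw [← Finset.card_product]
    refine (Finset.card_le_card ?_).trans (Finset.card_image_le (f := fun z => z.2 ^^^ z.1))
    intro k hk
    simp only [Finset.mem_filter, Finset.mem_univ, true_and, not_forall, not_not] at hk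
    obtain ⟨x, hx, y, hy, rfl⟩ := hk
    exact Finset.mem_image.2 ⟨(x, k ^^^ x), Finset.mem_product.2 ⟨hx, hy⟩, by simp⟩
  rw [← h]
  push_cast
  have := (Nat.cast_le (α := ℝ)).2 h2
  push_cast at this
  linarith

theorem card_mul_card_mul_le_sum {α : Type*} [Fintype α] {F : α → α → ℕ} {G₁ G₂ : Finset α} {L : ℕ}
    (h : ∀ k₁ ∈ G₁, ∀ k₂ ∈ G₂, L ≤ F k₁ k₂) : G₁.card * G₂.card * L ≤ ∑ k₁, ∑ k₂, F k₁ k₂ := by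
  calc G₁.card * G₂.card * L = ∑ _k₁ ∈ G₁, ∑ _k₂ ∈ G₂, L := by simp [mul_assoc]
    _ ≤ ∑ k₁ ∈ G₁, ∑ k₂ ∈ G₂, F k₁ k₂ :=
      Finset.sum_le_sum fun k₁ h₁ => Finset.sum_le_sum fun k₂ h₂ => h k₁ h₁ k₂ h₂
    _ ≤ ∑ k₁ ∈ G₁, ∑ k₂, F k₁ k₂ := Finset.sum_le_sum fun k₁ _ =>
      Finset.sum_le_univ_sum_of_nonneg fun _ => Nat.zero_le _
    _ ≤ _ := Finset.sum_le_univ_sum_of_nonneg fun _ => Nat.zero_le _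

theorem real_pairs_ratio_univ {n : ℕ} (p₁ p₂ p : Equiv.Perm (BitVec n)) (A B : Finset (BitVec n)) :
    (1 - 3 / 2 / √(Nat.card (BitVec n)) * ((A.card + B.card : ℕ) : ℝ)) *
        (Nat.card (BitVec n) : ℝ) ^ 2 *
        ((Nat.card (BitVec n) - A.card).factorial * (Nat.card (BitVec n) - B.card).factorial : ℕ) ≤
      ((Nat.card (BitVec n)).factorial * ∑ k₁, ∑ k₂,
        Nat.card {q : Equiv.Perm (BitVec n) × Equiv.Perm (BitVec n) //
          (∀ x ∈ A, q.1 x = p₁ x) ∧ (∀ x ∈ B, q.2 x = p₂ x) ∧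
          ∀ x, q.2 (whiten k₂ (q.1 (whiten k₁ x))) = p x} : ℕ) := by
  set N := Nat.card (BitVec n)
  have hN1 : 1 ≤ N := Nat.card_pos
  have hN1' : (1 : ℝ) ≤ N := by exact_mod_cast hN1
  have hN : (0 : ℝ) < N := by linarith
  have hs : 0 < √(N : ℝ) := Real.sqrt_pos.2 hN
  have hss : √(N : ℝ) * √N = N := Real.mul_self_sqrt hN.le
  set t : ℝ := ((A.card + B.card : ℕ) : ℝ) / √N with ht
  have ht0 : 0 ≤ t := by positivity
  rw [show 3 / 2 / √(N : ℝ) * ((A.card + B.card : ℕ) : ℝ) = 3 / 2 * t by rw [ht]; ring]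
  rcases le_or_gt (2 / 3) t with hbig | hsmall
  · refine le_trans (mul_nonpos_of_nonpos_of_nonneg
      (mul_nonpos_of_nonpos_of_nonneg (by linarith) (by positivity)) (by positivity)) (by positivity)
  have hts : ((A.card + B.card : ℕ) : ℝ) = t * √N := by rw [ht]; field_simp
  have hsN : √(N : ℝ) ≤ N := by nlinarith [Real.one_le_sqrt.2 hN1']
  have hab : A.card + B.card ≤ N := by
    have : ((A.card + B.card : ℕ) : ℝ) ≤ N := by rw [hts]; nlinarith
    exact_mod_cast this
  set G₁ := Finset.univ.filter fun k : BitVec n =>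
    ∀ x ∈ B.image (fun b => p.symm (p₂ b)), ∀ y ∈ A, k ^^^ x ≠ y with hG₁
  set G₂ := Finset.univ.filter fun k : BitVec n => ∀ x ∈ A.image p₁, ∀ y ∈ B, k ^^^ x ≠ y with hG₂
  have hsum := card_mul_card_mul_le_sum (G₁ := G₁) (G₂ := G₂) (L := (N - (A.card + B.card)).factorial)
    (F := fun k₁ k₂ => Nat.card {q : Equiv.Perm (BitVec n) × Equiv.Perm (BitVec n) //
          (∀ x ∈ A, q.1 x = p₁ x) ∧ (∀ x ∈ B, q.2 x = p₂ x) ∧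
          ∀ x, q.2 (whiten k₂ (q.1 (whiten k₁ x))) = p x}) (by
    intro k₁ hk₁ k₂ hk₂
    refine factorial_le_card_pairs_comp_eq p₁ p₂ p (whiten k₁) (whiten k₂) A B ?_ ?_
    · exact fun a ha b hb => (Finset.mem_filter.1 hk₁).2 _ (Finset.mem_image_of_mem _ hb) a ha
    · exact fun a ha b hb => (Finset.mem_filter.1 hk₂).2 _ (Finset.mem_image_of_mem _ ha) b hb)
  have hab2 : (A.card : ℝ) * B.card ≤ t ^ 2 / 4 * N := by
    have : ((A.card + B.card : ℕ) : ℝ) ^ 2 = t ^ 2 * N := by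
      rw [hts, mul_pow, Real.sq_sqrt hN.le]
    push_cast at this
    nlinarith [sq_nonneg ((A.card : ℝ) - B.card)]
  have hg1 : (1 - t ^ 2 / 4) * N ≤ G₁.card := by
    have h1 := card_sub_mul_le_card_xor_ne (B.image fun b => p.symm (p₂ b)) A
    have h2 : ((B.image fun b => p.symm (p₂ b)).card : ℝ) ≤ B.card := by
      exact_mod_cast Finset.card_image_le
    have h3 := mul_le_mul_of_nonneg_right h2 (Nat.cast_nonneg (α := ℝ) A.card)
    linarith
  have hg2 : (1 - t ^ 2 / 4) * N ≤ G₂.card := by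
    have h1 := card_sub_mul_le_card_xor_ne (A.image p₁) B
    have h2 : ((A.image p₁).card : ℝ) ≤ A.card := by
      exact_mod_cast Finset.card_image_le
    have h3 := mul_le_mul_of_nonneg_right h2 (Nat.cast_nonneg (α := ℝ) B.card)
    linarith
  have ht1 : 0 ≤ (1 - t ^ 2 / 4) * (N : ℝ) := mul_nonneg (by nlinarith) hN.le
  have hfac := (Nat.cast_le (α := ℝ)).2 (factorial_sub_mul_factorial_sub_le hab)
  have hsum' := (Nat.cast_le (α := ℝ)).2 (Nat.mul_le_mul_left N.factorial hsum)
  refine le_trans ?_ hsum'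
  calc _ ≤ (G₁.card * G₂.card : ℝ) * (N.factorial * (N - (A.card + B.card)).factorial : ℕ) := by
        refine mul_le_mul ?_ hfac (Nat.cast_nonneg _)
          (mul_nonneg (Nat.cast_nonneg _) (Nat.cast_nonneg _))
        refine le_trans ?_ (mul_le_mul hg1 hg2 ht1 (Nat.cast_nonneg _))
        have : 1 - 3 / 2 * t ≤ (1 - t ^ 2 / 4) * (1 - t ^ 2 / 4) := by nlinarith [sq_nonneg (t ^ 2)]
        nlinarith [mul_le_mul_of_nonneg_right this (sq_nonneg (N : ℝ))]
    _ = _ := by push_cast; ring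

set_option maxHeartbeats 1000000 in
theorem one_sub_mul_factorials_le {N a b q u h D g₁ g₂ : ℕ} {M : ℝ} (hN1 : 0 < N) (huh : u + h = q)
    (hq : q ≤ D) (hMD : 0 < (N : ℝ) - M - D + 1) (hsmall : (a + b : ℝ) ≤ M)
    (h₁ : (N : ℝ) - q * a ≤ g₁) (h₂ : (N : ℝ) - a * h ≤ g₂) :
    (1 - (D * (M ^ 2 / 4) / (((N : ℝ) - D + 1) * ((N : ℝ) - M - D + 1))
        + (3 / 2 * D / N + 1 / M) * (a + b))) * (N : ℝ) ^ 2 *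
        ((N - a).factorial * (N - b).factorial * (N - q).factorial : ℕ) ≤
      (g₁ * g₂ : ℝ) * (N.factorial * ((N - (a + b)).descFactorial u *
        ((N - (a + q)).factorial * (N - (b + u)).factorial)) : ℕ) := by
  have hN : (0 : ℝ) < N := by exact_mod_cast hN1
  have ha0 : (0 : ℝ) ≤ a := by positivity
  have hb0 : (0 : ℝ) ≤ b := by positivity
  have hM0 : 0 ≤ M := by linarith
  have hND : 0 < (N : ℝ) - D + 1 := by linarith
  set δ : ℝ := D * (M ^ 2 / 4) / (((N : ℝ) - D + 1) * ((N : ℝ) - M - D + 1)) with hδ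
  have hqD : (q : ℝ) ≤ D := by exact_mod_cast hq
  have hhq : (h : ℝ) ≤ q := by exact_mod_cast (by omega : h ≤ q)
  have huq : (u : ℝ) ≤ q := by exact_mod_cast (by omega : u ≤ q)
  have habq : a + b + (u + h) ≤ N := by
    have : ((a + b + q : ℕ) : ℝ) < (N + 1 : ℕ) := by push_cast; linarith
    rw [huh]
    exact Nat.lt_succ_iff.1 (by exact_mod_cast this)
  have hg1 : 1 - (a + b : ℝ) * D / N ≤ g₁ / N := by
    rw [le_div_iff₀ hN, sub_mul, div_mul_cancel₀ _ hN.ne', one_mul]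
    nlinarith [mul_le_mul_of_nonneg_right hqD ha0, mul_nonneg hb0 (Nat.cast_nonneg (α := ℝ) D)]
  have hg2 : 1 - h * (a / N : ℝ) ≤ g₂ / N := by
    rw [le_div_iff₀ hN, sub_mul, mul_assoc, div_mul_cancel₀ _ hN.ne', one_mul]
    linarith
  set m : ℝ := N - q + 1 with hm
  have hmD : (N : ℝ) - D + 1 ≤ m := by linarith
  have hma : 0 < m - a := by linarith
  have hmb : 0 < m - b := by linarith
  have hmab : ((N : ℝ) - D + 1) * ((N : ℝ) - M - D + 1) ≤ (m - a) * (m - b) := by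
    have : ((N : ℝ) - D + 1) * ((N : ℝ) - M - D + 1) ≤ m * (m - (a + b)) :=
      mul_le_mul hmD (by linarith) hMD.le (by linarith)
    nlinarith [mul_nonneg ha0 hb0]
  have hab4 : (a : ℝ) * b ≤ M ^ 2 / 4 := by
    nlinarith [sq_nonneg ((a : ℝ) - b), mul_self_le_mul_self (add_nonneg ha0 hb0) hsmall]
  set c : ℝ := (a : ℝ) * b / ((m - a) * (m - b)) with hc
  have hc0 : 0 ≤ c := by positivity
  have hcm : c * ((m - a) * (m - b)) = a * b := div_mul_cancel₀ _ (by positivity)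
  have hc1 : c ≤ 1 := by
    rw [hc, div_le_one (by positivity)]
    nlinarith [mul_nonneg (by linarith : 0 ≤ m) (by linarith : 0 ≤ m - (a + b))]
  have hcδ : u * c ≤ δ := by
    rw [hc, hδ, mul_div_assoc (D : ℝ)]
    refine mul_le_mul (huq.trans hqD) ?_ (by positivity) (by positivity)
    exact div_le_div₀ (by positivity) hab4 (by positivity) hmab
  have hratio := pow_mul_factorials_le (N := N) (a := a) (b := b) (u := u) (h := h)
    hN1 hc1 habq (by
      intro i hi
      have hi' : (i : ℝ) + 1 ≤ u := by exact_mod_cast hi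
      have hz : m ≤ N - i := by linarith
      have : (m - a) * (m - b) ≤ (N - i - a) * (N - i - b) :=
        mul_le_mul (by linarith) (by linarith) hmb.le (by linarith)
      nlinarith [mul_le_mul_of_nonneg_left this hc0])
  have hprob := one_sub_le_pow_mul (c := c) (δ := δ) (r := a / N) (u := h * (a / N))
    (v := (a + b) * D / N) (j := u) (h := h) hc0 hc1 hcδ (by positivity) rfl (by
      rw [← mul_div_assoc]
      refine div_le_div_of_nonneg_right ?_ hN.le
      nlinarith [mul_le_mul_of_nonneg_right (hhq.trans hqD) ha0,
        mul_nonneg hb0 (Nat.cast_nonneg (α := ℝ) D)]) hg1 hg2 (by positivity) (by positivity)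
  have hM' : 0 ≤ 1 / M * (a + b : ℝ) := by positivity
  rw [huh] at hratio
  calc _ ≤ ((1 - c) ^ u * (1 + a / N) ^ h * (g₁ / N * (g₂ / N))) * (N : ℝ) ^ 2 *
        ((N - a).factorial * (N - b).factorial * (N - q).factorial : ℕ) := by
        gcongr
        refine le_trans ?_ hprob
        have : (3 / 2 * D / N + 1 / M) * (a + b : ℝ) = 3 / 2 * ((a + b) * D / N) + 1 / M * (a + b) := by
          ring
        linarith
    _ = (g₁ * g₂ : ℝ) * ((1 - c) ^ u * (1 + a / N) ^ h *
        ((N - a).factorial * (N - b).factorial * (N - q).factorial : ℕ)) := by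
        field_simp
    _ ≤ _ := mul_le_mul_of_nonneg_left hratio (by positivity)

theorem real_pairs_ratio_on {n D : ℕ} {M : ℝ} (p₁ p₂ p : Equiv.Perm (BitVec n))
    (A B Q : Finset (BitVec n)) (hQ : Q.card ≤ D) (hM0 : 0 ≤ M) (hM : M = 0 → A.card + B.card = 0)
    (hMD : 0 < (Nat.card (BitVec n) : ℝ) - M - D + 1) :
    (1 - (D * (M ^ 2 / 4) / (((Nat.card (BitVec n) : ℝ) - D + 1) * ((Nat.card (BitVec n) : ℝ) - M - D + 1))
        + (3 / 2 * D / Nat.card (BitVec n) + 1 / M) * ((A.card + B.card : ℕ) : ℝ))) *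
        (Nat.card (BitVec n) : ℝ) ^ 2 *
        ((Nat.card (BitVec n) - A.card).factorial * (Nat.card (BitVec n) - B.card).factorial *
          (Nat.card (BitVec n) - Q.card).factorial : ℕ) ≤
      ((Nat.card (BitVec n)).factorial * ∑ k₁, ∑ k₂,
        Nat.card {q : Equiv.Perm (BitVec n) × Equiv.Perm (BitVec n) //
          (∀ x ∈ A, q.1 x = p₁ x) ∧ (∀ x ∈ B, q.2 x = p₂ x) ∧
          ∀ x ∈ Q, q.2 (whiten k₂ (q.1 (whiten k₁ x))) = p x} : ℕ) := by
  set N := Nat.card (BitVec n)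
  have hN1 : 0 < N := Nat.card_pos
  have hN : (0 : ℝ) < N := by exact_mod_cast hN1
  have hND : 0 < (N : ℝ) - D + 1 := by linarith
  rcases lt_or_ge M ((A.card + B.card : ℕ) : ℝ) with hbig | hsmall
  · have hM1 : 0 < M := lt_of_le_of_ne hM0 fun h0 => by
      rw [hM h0.symm, ← h0] at hbig; simp at hbig
    have h1 : 1 ≤ 1 / M * ((A.card + B.card : ℕ) : ℝ) := by
      rw [one_div, ← div_eq_inv_mul, one_le_div hM1]; exact hbig.le
    have h2 : 0 ≤ 3 / 2 * D / N * ((A.card + B.card : ℕ) : ℝ) := by positivity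
    have h3 : 0 ≤ D * (M ^ 2 / 4) / (((N : ℝ) - D + 1) * ((N : ℝ) - M - D + 1)) := by positivity
    refine le_trans (mul_nonpos_of_nonpos_of_nonneg
      (mul_nonpos_of_nonpos_of_nonneg (by linarith) (by positivity)) (Nat.cast_nonneg _))
      (Nat.cast_nonneg _)
  set H := Q.filter fun x => p₂.symm (p x) ∈ B with hH
  set U := Q.filter fun x => p₂.symm (p x) ∉ B with hU
  have hHU : U.card + H.card = Q.card := by
    rw [add_comm]; exact Finset.card_filter_add_card_filter_not _
  set G₁ := Finset.univ.filter fun k : BitVec n => ∀ x ∈ Q, ∀ y ∈ A, k ^^^ x ≠ y with hG₁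
  set G₂ := Finset.univ.filter fun k : BitVec n =>
    ∀ x ∈ A.image p₁, ∀ y ∈ H.image (fun x => p₂.symm (p x)), k ^^^ x ≠ y with hG₂
  have hsum := card_mul_card_mul_le_sum (G₁ := G₁) (G₂ := G₂)
    (L := (N - (A.card + B.card)).descFactorial U.card *
      ((N - (A.card + Q.card)).factorial * (N - (B.card + U.card)).factorial))
    (F := fun k₁ k₂ => Nat.card {q : Equiv.Perm (BitVec n) × Equiv.Perm (BitVec n) //
          (∀ x ∈ A, q.1 x = p₁ x) ∧ (∀ x ∈ B, q.2 x = p₂ x) ∧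
          ∀ x ∈ Q, q.2 (whiten k₂ (q.1 (whiten k₁ x))) = p x}) (by
    intro k₁ hk₁ k₂ hk₂
    refine descFactorial_mul_le_card_pairs_comp_eq_on p₁ p₂ p (whiten k₁) (whiten k₂) A B Q ?_ ?_
    · exact fun x hx ha => (Finset.mem_filter.1 hk₁).2 x hx _ ha rfl
    · exact fun x hx hB a ha => (Finset.mem_filter.1 hk₂).2 _ (Finset.mem_image_of_mem _ ha) _
        (Finset.mem_image_of_mem _ (Finset.mem_filter.2 ⟨hx, hB⟩)))
  have hg2 : (N : ℝ) - A.card * H.card ≤ G₂.card := by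
    have h1 := card_sub_mul_le_card_xor_ne (A.image p₁) (H.image fun x => p₂.symm (p x))
    have h2 : ((A.image p₁).card : ℝ) ≤ A.card := by exact_mod_cast Finset.card_image_le
    have h3 : ((H.image fun x => p₂.symm (p x)).card : ℝ) ≤ H.card := by
      exact_mod_cast Finset.card_image_le
    have h4 := mul_le_mul h2 h3 (Nat.cast_nonneg _) (Nat.cast_nonneg _)
    linarith
  have hnum := one_sub_mul_factorials_le (b := B.card) hN1 hHU hQ hMD (by exact_mod_cast hsmall)
    (card_sub_mul_le_card_xor_ne Q A) hg2
  have hsum' := (Nat.cast_le (α := ℝ)).2 (Nat.mul_le_mul_left N.factorial hsum)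
  refine le_trans ?_ hsum'
  rw [mul_left_comm, Nat.cast_mul (_ * _) (_ * _), Nat.cast_mul G₁.card, Nat.cast_add]
  exact hnum

namespace Strategy

variable {κ n : ℕ}

/-- The output bit of a strategy in the real world. -/
noncomputable def realOutput (s : Strategy κ n) : PMF Bool := do
  let E ← PMF.uniformOfFintype (Fin 2 → BlockCipher κ n)
  let k ← PMF.uniformOfFintype (BitVec κ)
  let k₁ ← PMF.uniformOfFintype (BitVec n)
  let k₂ ← PMF.uniformOfFintype (BitVec n)
  return s.run E (EFX E k k₁ k₂)

/-- The output bit of a strategy in the ideal world. -/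
noncomputable def idealOutput (s : Strategy κ n) : PMF Bool := do
  let E ← PMF.uniformOfFintype (Fin 2 → BlockCipher κ n)
  let p ← PMF.uniformOfFintype (Equiv.Perm (BitVec n))
  return s.run E p

end Strategy

theorem PMF.toReal_uniformOfFintype_bind {α β : Type} [Fintype α] [Nonempty α] (f : α → PMF β)
    (b : β) : (((PMF.uniformOfFintype α).bind f) b).toReal = (∑ a, (f a b).toReal) / Fintype.card α := by
  rw [PMF.bind_apply, tsum_fintype, ENNReal.toReal_sum, Finset.sum_div]
  · refine Finset.sum_congr rfl fun a _ => ?_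
    rw [PMF.uniformOfFintype_apply, ENNReal.toReal_mul, ENNReal.toReal_inv, ENNReal.toReal_natCast]
    ring
  · exact fun a _ => ENNReal.mul_ne_top (PMF.apply_ne_top _ _) (PMF.apply_ne_top _ _)

theorem PMF.toReal_pure_true (b : Bool) :
    ((PMF.pure b : PMF Bool) true).toReal = if b = true then 1 else 0 := by
  cases b <;> simp [PMF.pure_apply]

namespace Strategy

variable {κ n : ℕ}

theorem toReal_idealOutput (s : Strategy κ n) : (s.idealOutput true).toReal =
    (∑ ω : (Fin 2 → BlockCipher κ n) × Equiv.Perm (BitVec n),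
      if s.run ω.1 ω.2 = true then (1 : ℝ) else 0) /
      Fintype.card ((Fin 2 → BlockCipher κ n) × Equiv.Perm (BitVec n)) := by
  change (((PMF.uniformOfFintype _).bind fun E => (PMF.uniformOfFintype _).bind fun p =>
    PMF.pure (s.run E p)) true).toReal = _
  simp only [PMF.toReal_uniformOfFintype_bind, PMF.toReal_pure_true, Fintype.sum_prod_type,
    Fintype.card_prod, ← Finset.sum_div, div_div, Nat.cast_mul]
  rw [mul_comm]

theorem toReal_realOutput (s : Strategy κ n) : (s.realOutput true).toReal =
    (∑ k, (∑ r : (Fin 2 → BlockCipher κ n) × BitVec n × BitVec n,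
        if s.run r.1 (EFX r.1 k r.2.1 r.2.2) = true then (1 : ℝ) else 0) /
        Fintype.card ((Fin 2 → BlockCipher κ n) × BitVec n × BitVec n)) /
      Fintype.card (BitVec κ) := by
  change (((PMF.uniformOfFintype _).bind fun E => (PMF.uniformOfFintype _).bind fun k =>
    (PMF.uniformOfFintype _).bind fun k₁ => (PMF.uniformOfFintype _).bind fun k₂ =>
    PMF.pure (s.run E (EFX E k k₁ k₂))) true).toReal = _
  simp only [PMF.toReal_uniformOfFintype_bind, PMF.toReal_pure_true, Fintype.sum_prod_type,
    Fintype.card_prod, ← Finset.sum_div, div_div, Nat.cast_mul]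
  rw [Finset.sum_comm]
  congr 1
  ring

/-- If the transcripts have ratio at least `1 - ε` with `ε` affine in the number of queries under
the key, the advantage is at most the average of `ε`. -/
theorem toReal_realOutput_le {s : Strategy κ n} {D T : ℕ} (hs : s.QueryBound D T)
    {Q : (Fin 2 → BlockCipher κ n) × Equiv.Perm (BitVec n) → Finset (BitVec n)}
    (hQ : s.IsOnlineCover Q) {δ c : ℝ} (hδ : 0 ≤ δ) (hc : 0 ≤ c)
    (h : ∀ k ω, (1 - (δ + c * ((s.keyPoints ω k 0).card + (s.keyPoints ω k 1).card : ℕ))) *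
        (Nat.card (BitVec n) : ℝ) ^ 2 *
        ((Nat.card (BitVec n) - (s.keyPoints ω k 0).card).factorial *
          (Nat.card (BitVec n) - (s.keyPoints ω k 1).card).factorial *
          (Nat.card (BitVec n) - (Q ω).card).factorial : ℕ) ≤
        ((Nat.card (BitVec n)).factorial *
          ∑ k₁, ∑ k₂, Nat.card (s.RealPairs Q k ω k₁ k₂) : ℕ)) :
    (s.realOutput true).toReal ≤ (s.idealOutput true).toReal + (δ + c * T / 2 ^ κ) := by
  rw [toReal_realOutput, toReal_idealOutput]
  have hk := fun k => real_sub_ideal_le_of_ratio hQ k _ (fun ω => by positivity) (h k)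
  have hK : (Fintype.card (BitVec κ) : ℝ) = 2 ^ κ := by
    rw [Fintype.card_congr (BitVec.equivFin (m := κ)).toEquiv]; simp
  have hΩ : (0 : ℝ) < Fintype.card ((Fin 2 → BlockCipher κ n) × Equiv.Perm (BitVec n)) := by
    exact_mod_cast Fintype.card_pos
  rw [hK, div_le_iff₀ (by positivity)]
  refine (Finset.sum_le_sum fun k _ => hk k).trans ?_
  rw [Finset.sum_add_distrib, Finset.sum_const, Finset.card_univ, nsmul_eq_mul, hK, add_mul,
    mul_comm, add_le_add_iff_left, ← Finset.sum_div, Finset.sum_comm, div_le_iff₀ hΩ, add_mul,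
    div_mul_cancel₀ _ (by positivity)]
  have hω : ∀ ω : (Fin 2 → BlockCipher κ n) × Equiv.Perm (BitVec n),
      ∑ k, (δ + c * ((s.keyPoints ω k 0).card + (s.keyPoints ω k 1).card : ℕ)) ≤
        δ * 2 ^ κ + c * T := by
    intro ω
    rw [Finset.sum_add_distrib, Finset.sum_const, Finset.card_univ, nsmul_eq_mul, hK,
      ← Finset.mul_sum, ← Nat.cast_sum, sum_card_keyPoints, mul_comm]
    gcongr
    exact (hs ω.1 ω.2).2
  refine (Finset.sum_le_sum fun ω _ => hω ω).trans ?_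
  rw [Finset.sum_const, Finset.card_univ, nsmul_eq_mul, mul_comm]

end Strategy

theorem advSPRP_le_of_forall {κ n : ℕ} (A : Adversary κ n) {c : ℝ} (hc : 0 ≤ c)
    (h : ∀ s ∈ A.support, (s.realOutput true).toReal ≤ (s.idealOutput true).toReal + c) :
    advSPRP A ≤ c := by
  have hr : realWorld A = A.bind Strategy.realOutput := rfl
  have hi : idealWorld A = A.bind Strategy.idealOutput := rfl
  have key : realWorld A true ≤ idealWorld A true + ENNReal.ofReal c := by
    rw [hr, hi, PMF.bind_apply, PMF.bind_apply]
    calc ∑' s, A s * s.realOutput true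
        ≤ ∑' s, (A s * s.idealOutput true + A s * ENNReal.ofReal c) := by
          refine ENNReal.tsum_le_tsum fun s => ?_
          by_cases hs : s ∈ A.support
          · rw [← mul_add]
            refine mul_le_mul_right ?_ _
            rw [← ENNReal.ofReal_toReal (PMF.apply_ne_top s.realOutput true),
              ← ENNReal.ofReal_toReal (PMF.apply_ne_top s.idealOutput true),
              ← ENNReal.ofReal_add ENNReal.toReal_nonneg hc]
            exact ENNReal.ofReal_le_ofReal (h s hs)
          · rw [(PMF.apply_eq_zero_iff _ _).2 hs]; simp
      _ = _ := by rw [ENNReal.tsum_add, ENNReal.tsum_mul_right, PMF.tsum_coe, one_mul]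
  have hne : idealWorld A true ≠ ⊤ := PMF.apply_ne_top _ _
  have := ENNReal.toReal_mono (ENNReal.add_ne_top.2 ⟨hne, ENNReal.ofReal_ne_top⟩) key
  rw [ENNReal.toReal_add hne ENNReal.ofReal_ne_top, ENNReal.toReal_ofReal hc] at this
  unfold advSPRP
  linarith

theorem natCard_bitVec (n : ℕ) : (Nat.card (BitVec n) : ℝ) = 2 ^ n := by
  rw [Nat.card_congr (BitVec.equivFin (m := n)).toEquiv]; simp

theorem Strategy.realOutput_le_univ {κ n D T : ℕ} {s : Strategy κ n} (hs : s.QueryBound D T) :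
    (s.realOutput true).toReal ≤
      (s.idealOutput true).toReal + (0 + 3 / 2 / √(Nat.card (BitVec n)) * T / 2 ^ κ) := by
  refine Strategy.toReal_realOutput_le hs (Q := fun _ => Finset.univ)
    ⟨fun _ => Finset.subset_univ _, fun _ _ _ => rfl⟩ le_rfl (by positivity) fun k ω => ?_
  have := real_pairs_ratio_univ (ω.1 0 k) (ω.1 1 k) ω.2 (s.keyPoints ω k 0) (s.keyPoints ω k 1)
  rw [zero_add, Finset.card_univ, ← Nat.card_eq_fintype_card, Nat.sub_self, Nat.factorial_zero,
    mul_one]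
  simpa only [Strategy.RealPairs, Finset.mem_univ, true_imp_iff] using this

theorem Strategy.realOutput_le_on {κ n D T : ℕ} {s : Strategy κ n} (hs : s.QueryBound D T) {M : ℝ}
    (hM0 : 0 ≤ M) (hM : M = 0 → T = 0) (hMD : 0 < (Nat.card (BitVec n) : ℝ) - M - D + 1) :
    (s.realOutput true).toReal ≤ (s.idealOutput true).toReal +
      (D * (M ^ 2 / 4) /
          (((Nat.card (BitVec n) : ℝ) - D + 1) * ((Nat.card (BitVec n) : ℝ) - M - D + 1)) +
        (3 / 2 * D / Nat.card (BitVec n) + 1 / M) * T / 2 ^ κ) := by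
  have hND : 0 < (Nat.card (BitVec n) : ℝ) - D + 1 := by linarith
  refine Strategy.toReal_realOutput_le hs (Q := fun ω => s.onlinePoints ω.1 ω.2)
    ⟨fun _ => subset_rfl, fun _ _ h => h⟩ (by positivity) (by positivity) fun k ω => ?_
  refine real_pairs_ratio_on (ω.1 0 k) (ω.1 1 k) ω.2 _ _ _ (hs ω.1 ω.2).1 hM0 (fun h => ?_) hMD
  have h1 := (hs ω.1 ω.2).2
  rw [hM h, ← s.sum_card_keyPoints ω] at h1
  exact Nat.le_zero.1 ((Finset.single_le_sum (f := fun k => (s.keyPoints ω k 0).card +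
    (s.keyPoints ω k 1).card) (fun _ _ => Nat.zero_le _) (Finset.mem_univ k)).trans h1)

theorem rpow_pow_three_third {x : ℝ} (hx : 0 ≤ x) : (x ^ 3) ^ (1 / 3 : ℝ) = x := by
  rw [← Real.rpow_natCast x 3, ← Real.rpow_mul hx]; norm_num

theorem mainTheorem3 (κ n D T : ℕ) (A : Adversary κ n) (hA : A.QueryBound D T) :
    (0 < D →
      0 < (2 : ℝ) ^ n - ((T : ℝ) / D * (2 ^ (2 * n) / 2 ^ κ)) ^ (1 / 3 : ℝ) - D + 1 →
      advSPRP A ≤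
        3 / 2 * ((T : ℝ) * D / 2 ^ (κ + n))
        + ((T : ℝ) ^ 2 * D / 2 ^ (2 * κ + 2 * n)) ^ (1 / 3 : ℝ)
        + ((2 : ℝ) ^ (4 * n) * (T : ℝ) ^ 2 * D /
            (2 ^ (2 * (κ + 1)) * ((2 : ℝ) ^ n - D + 1) ^ 3 *
              ((2 : ℝ) ^ n - ((T : ℝ) / D * (2 ^ (2 * n) / 2 ^ κ)) ^ (1 / 3 : ℝ) - D + 1) ^ 3))
            ^ (1 / 3 : ℝ)) ∧
    advSPRP A ≤ 3 / 2 * ((T : ℝ) / 2 ^ ((κ : ℝ) + (n : ℝ) / 2)) := by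
  constructor
  · intro hD hMD
    have hD0 : (0 : ℝ) < D := by exact_mod_cast hD
    set M : ℝ := ((T : ℝ) / D * (2 ^ (2 * n) / 2 ^ κ)) ^ (1 / 3 : ℝ) with hMdef
    have hM0 : 0 ≤ M := by positivity
    have hM3 : M ^ 3 = (T : ℝ) / D * (2 ^ (2 * n) / 2 ^ κ) := by
      rw [hMdef, ← Real.rpow_natCast, ← Real.rpow_mul (by positivity)]; norm_num
    have hMT : M = 0 → T = 0 := by
      intro h
      rw [h] at hM3
      have h2 : (0 : ℝ) < 2 ^ (2 * n) / 2 ^ κ / D := by positivity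
      have h3 : (T : ℝ) * (2 ^ (2 * n) / 2 ^ κ / D) = 0 := by
        rw [← zero_pow (M₀ := ℝ) three_ne_zero, hM3]; ring
      exact_mod_cast (mul_eq_zero.1 h3).resolve_right h2.ne'
    have hND : 0 < (2 : ℝ) ^ n - D + 1 := by linarith
    refine (advSPRP_le_of_forall A ?_ fun s hs =>
      Strategy.realOutput_le_on (hA s hs) hM0 hMT (by rwa [natCard_bitVec])).trans ?_
    · rw [natCard_bitVec]; positivity
    rw [natCard_bitVec]
    clear_value M
    have h1 : 1 / M * T / 2 ^ κ ≤ ((T : ℝ) ^ 2 * D / 2 ^ (2 * κ + 2 * n)) ^ (1 / 3 : ℝ) := by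
      rcases hM0.eq_or_lt with h | h
      · rw [← h]; simp only [div_zero, zero_mul, zero_div]; positivity
      · have hT : (0 : ℝ) < T := by
          rcases Nat.eq_zero_or_pos T with h0 | h0
          · have : 0 < M ^ 3 := by positivity
            rw [hM3, h0] at this; simp at this
          · exact_mod_cast h0
        rw [← rpow_pow_three_third (x := 1 / M * T / 2 ^ κ) (by positivity)]
        refine Real.rpow_le_rpow (by positivity) (le_of_eq ?_) (by norm_num)
        rw [div_pow, mul_pow, div_pow, hM3]
        field_simp
        ring
    have h2 : D * (M ^ 2 / 4) / (((2 : ℝ) ^ n - D + 1) * ((2 : ℝ) ^ n - M - D + 1)) ≤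
        ((2 : ℝ) ^ (4 * n) * (T : ℝ) ^ 2 * D / (2 ^ (2 * (κ + 1)) * ((2 : ℝ) ^ n - D + 1) ^ 3 *
          ((2 : ℝ) ^ n - M - D + 1) ^ 3)) ^ (1 / 3 : ℝ) := by
      rw [← rpow_pow_three_third (x := D * (M ^ 2 / 4) / (_ * _)) (by positivity)]
      refine Real.rpow_le_rpow (by positivity) ?_ (by norm_num)
      have e : (D * (M ^ 2 / 4)) ^ 3 = 1 / 16 * ((2 : ℝ) ^ (4 * n) * (T : ℝ) ^ 2 * D /
          2 ^ (2 * (κ + 1))) := by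
        rw [show ((D : ℝ) * (M ^ 2 / 4)) ^ 3 = D ^ 3 * (M ^ 3) ^ 2 / 64 by ring, hM3]
        field_simp
        ring
      rw [div_pow, e, mul_pow, mul_assoc (2 ^ (2 * (κ + 1))), ← div_div _ (2 ^ (2 * (κ + 1)))]
      refine div_le_div_of_nonneg_right ?_ (by positivity)
      have : 0 ≤ (2 : ℝ) ^ (4 * n) * (T : ℝ) ^ 2 * D / 2 ^ (2 * (κ + 1)) := by positivity
      linarith
    have h3 : (3 / 2 * D / 2 ^ n + 1 / M) * T / 2 ^ κ =
        3 / 2 * ((T : ℝ) * D / 2 ^ (κ + n)) + 1 / M * T / 2 ^ κ := by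
      rw [pow_add]; field_simp
    rw [h3]
    linarith
  · refine (advSPRP_le_of_forall A (by positivity) fun s hs =>
      Strategy.realOutput_le_univ (hA s hs)).trans (le_of_eq ?_)
    rw [natCard_bitVec, Real.rpow_add two_pos, Real.rpow_natCast, Real.sqrt_eq_rpow,
      ← Real.rpow_natCast 2 n, ← Real.rpow_mul zero_le_two, zero_add]
    rw [show (n : ℝ) * (1 / 2) = n / 2 by ring]
    field_simp
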